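/- Let $M$ be a matroid of rank $n$ on a finite ground set $E$ that is $n$-paving, i.e. every circuit of $M$ has size $n$ or $n+1$. Definitions. For a matroid $N$ on a finite ground set, let $\mathcal{L}_N$ be the set of equivalence classes of circuits of $N$ of size less than $\operatorname{rank}(N)+1$, where $C_1\sim C_2$ if and only if $C_1$ and $C_2$ have the same closure in $N$ (for an $n$-paving matroid these classes are called its dependent hyperplanes). A point $p$ of $N$ belongs to $l\in\mathcal{L}_N$ if $p\in C$ for some circuit $C\in l$, and the degree of $p$ in $N$ is the number of $l\in\mathcal{L}_N$ to which $p$ belongs. Let $S_N$ be the set of points of $N$ of degree greater than $1$ in $N$, regarded as a submatroid (restriction) of $N$. The matroid $M$ is nilpotent if the chain $M_0=M$, $M_{j+1}=S_{M_j}$ satisfies $M_j=\emptyset$ for some $j$. Identify collections of vectors $(\gamma_p)_{p\in E}$ in $\mathbb{C}^n$ with points of the affine space of $n\times E$ complex matrices (the $\gamma_p$ being the columns). Let $\Gamma_M$ be the set of collections $\gamma$ such that, for every $I\subseteq E$, the family $(\gamma_p)_{p\in I}$ is linearly independent if and only if $I$ is independent in $M$. The matroid variety $V_M$ is the Zariski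 closure of $\Gamma_M$. The circuit variety $V_{\mathcal{C}(M)}$ is the common zero set of all minors $[A|B]_X$ of the generic $n\times E$ matrix $X$, where $B$ is a circuit of $M$, $A\subseteq\{1,\dots,n\}$ and $|A|=|B|$. Theorem. If the $n$-paving matroid $M$ is nilpotent and every point of $M$ has degree at most $2$ in $M$, then $$V_M=V_{\mathcal{C}(M)}.$$ -/

import Mathlib

namespace MatVar

variable {α : Type*}

/-- The circuits of `M` of size less than `rank M + 1`. -/
abbrev SmallCircuit (M : Matroid α) : Type _ :=
  {C : Set α // M.IsCircuit C ∧ C.encard < M.eRank + 1}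

/-- Two small circuits are equivalent when they have the same closure. -/
def smallCircuitSetoid (M : Matroid α) : Setoid (SmallCircuit M) where
  r C₁ C₂ := M.closure C₁.1 = M.closure C₂.1
  iseqv := ⟨fun _ => rfl, fun h => h.symm, fun h₁ h₂ => h₁.trans h₂⟩

/-- The set `𝓛_M` of subspaces of `M`: equivalence classes of small circuits. For a paving matroid
of rank `n` these are the dependent hyperplanes. -/
def DepSubspace (M : Matroid α) : Type _ := Quotient (smallCircuitSetoid M)

/-- The point `p` belongs to the subspace `l` when `p` lies in some circuit of the class `l`. -/
def DepSubspace.HasPoint {M : Matroid α} (l : DepSubspace M) (p : α) : Prop :=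
  ∃ C : SmallCircuit M, Quotient.mk (smallCircuitSetoid M) C = l ∧ p ∈ C.1

/-- The degree of `p`: the number of subspaces of `M` containing `p`. -/
noncomputable def degree (M : Matroid α) (p : α) : ℕ∞ :=
  {l : DepSubspace M | l.HasPoint p}.encard

/-- The set `S_M` of points of degree greater than one. -/
def multiplePoints (M : Matroid α) : Set α := {p ∈ M.E | 1 < degree M p}

/-- The nilpotent chain: `M₀ = M` and `Mⱼ₊₁` is the submatroid of `Mⱼ` on the points `S_{Mⱼ}`. -/
def nilpotentChain (M : Matroid α) : ℕ → Matroid α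
  | 0 => M
  | j + 1 => (nilpotentChain M j).restrict (multiplePoints (nilpotentChain M j))

/-- `M` is nilpotent when its nilpotent chain reaches the empty matroid. -/
def IsNilpotent (M : Matroid α) : Prop := ∃ j, (nilpotentChain M j).E = ∅

/-- `M` is an `n`-paving matroid: it has rank `n` and its circuits have size `n` or `n + 1`. -/
def IsPaving (M : Matroid α) (n : ℕ) : Prop :=
  M.eRank = n ∧ ∀ C, M.IsCircuit C → C.encard = n ∨ C.encard = n + 1

/-- The collection of vectors in `ℂ^d` (the columns) given by the entries `x` of a `d × M.E`
matrix. -/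
def columns {M : Matroid α} {d : ℕ} (x : Fin d × M.E → ℂ) (p : M.E) : Fin d → ℂ :=
  fun i => x (i, p)

/-- The realization space `Γ_{M,d}`: collections of vectors of `ℂ^d` indexed by the ground set
whose linearly independent subcollections are exactly the independent sets of `M`. -/
def realizationSpace (M : Matroid α) (d : ℕ) : Set (Fin d × M.E → ℂ) :=
  {x | ∀ I : Set M.E, LinearIndepOn ℂ (columns x) I ↔ M.Indep (Subtype.val '' I)}

/-- The matroid variety `V_{M,d}`: the Zariski closure of the realization space. -/
noncomputable def matroidVariety (M : Matroid α) (d : ℕ) : Set (Fin d × M.E → ℂ) :=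
  MvPolynomial.zeroLocus ℂ (MvPolynomial.vanishingIdeal ℂ (realizationSpace M d))

/-- The circuit ideal `I_{𝓒(M),d}`: generated by the minors `[A|B]` of the generic `d × M.E` matrix
with `B` a circuit and `|A| = |B|`. The injection `g` lists the columns of `B` in some order, which
only affects the sign of the minor. -/
noncomputable def circuitIdeal (M : Matroid α) (d : ℕ) :
    Ideal (MvPolynomial (Fin d × M.E) ℂ) :=
  Ideal.span {f | ∃ (A : Finset (Fin d)) (g : A → M.E), Function.Injective g ∧
    M.IsCircuit (Set.range fun i => (g i : α)) ∧
    f = ((Matrix.mvPolynomialX (Fin d) M.E ℂ).submatrix (fun i : A => (i : Fin d)) g).det}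

/-- The circuit variety `V_{𝓒(M),d}`. -/
noncomputable def circuitVariety (M : Matroid α) (d : ℕ) : Set (Fin d × M.E → ℂ) :=
  MvPolynomial.zeroLocus ℂ (circuitIdeal M d)

end MatVar

/-!
The variety of `M` lies in the circuit variety because the minors vanish on realizations. For the
converse, every point of the circuit variety is shown to be a limit of realizations in the Euclidean
topology, which is finer than the Zariski topology.

A configuration `γ` lies in the circuit variety exactly when the vectors of every dependent
hyperplane `v` of `M` are orthogonal to some nonzero `φ v`. What matters about `M` is collected in
`IsSparseIncidence`: a point lies on at most two dependent hyperplanes, two of them share at most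
`n - 2` points, and every nonempty set `T` of them has a member that shares at most `n - 1` points
with the rest of `T`. The last property comes from nilpotency
(`IsPaving.isSparseIncidence`): if it failed for `T`, the points common to two members of `T` would
survive in every step of the nilpotent chain.

The approximation has two parts.

* The linear hyperplanes can be made pairwise distinct (`mem_closure_distinctLocus`). After a
  generic movement of `γ` inside the given hyperplanes, coinciding hyperplanes are moved apart along
  `φ + t ψ`. A point `p` on two coinciding hyperplanes `v` and `w` can follow both as soon as
  `ψ v` and `ψ w` agree at `γ p` and `φ v`, `ψ v - ψ w` are independent. Taking the hyperplanes in
  the order provided by nilpotency, each new `ψ v` is subject to at most `n - 1` conditions, at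
  independent vectors of an `(n - 1)`-dimensional space (`exists_separating_velocities`).

* The configurations on pairwise distinct hyperplanes are among the values of a polynomial map on
  an affine space, by Cramer's rule (`kernelVector`, `config`). So it suffices that each of the
  finitely many determinants that must not vanish on a realization is nonzero for some parameter.
  For a given basis `B` of `M` this is easy: with the standard basis vectors placed at the points of
  `B`, normal vectors only need to vanish at prescribed coordinates (`exists_normals_of_basis`).
-/

open Matrix Topology
open scoped Matroid

namespace MatVar

/-! ### Moving vectors inside kernels -/

/-- Linearly independent functionals, written as vectors acting by dot product, take any prescribed
values at a common vector. -/
theorem exists_dotProduct_eq {ι : Type*} {n : ℕ} {f : ι → Fin n → ℂ}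
    (hf : LinearIndependent ℂ f) (c : ι → ℂ) : ∃ x, ∀ i, f i ⬝ᵥ x = c i := by
  obtain ⟨g, hg⟩ := LinearMap.exists_extend ((Module.Basis.span hf).constr ℂ c)
  refine ⟨(dotProductEquiv ℂ (Fin n)).symm g, fun i => ?_⟩
  have h1 : g (f i) = c i := by
    rw [← (Module.Basis.span hf).constr_basis ℂ c i, ← hg, LinearMap.comp_apply,
      Submodule.subtype_apply, Module.Basis.span_apply]
  rw [dotProduct_comm, ← h1]
  exact congrArg (fun h => h (f i)) ((dotProductEquiv ℂ (Fin n)).apply_symm_apply g)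

theorem exists_mul_eq_one {ι : Type*} [Fintype ι] [DecidableEq ι] {n : ℕ}
    {f : Matrix ι (Fin n) ℂ} (hf : LinearIndependent ℂ f) :
    ∃ a : Matrix (Fin n) ι ℂ, f * a = 1 := by
  choose a ha using fun j : ι => exists_dotProduct_eq hf (Pi.single j 1)
  refine ⟨(Matrix.of a)ᵀ, ?_⟩
  ext i j
  rw [Matrix.mul_apply']
  simpa [Matrix.one_apply, Pi.single_apply] using ha j i

/-- A vector killed by all rows of `f`, depending polynomially on `f`, `a` and `x`. It is obtained
from `x` by Cramer's rule, as the multiple of `x` by `det (f * a)` corrected by a combination of the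
columns of `a`. -/
noncomputable def kernelVector {ι : Type*} [Fintype ι] [DecidableEq ι] {n : ℕ}
    (f : Matrix ι (Fin n) ℂ) (a : Matrix (Fin n) ι ℂ) (x : Fin n → ℂ) : Fin n → ℂ :=
  (f * a).det • x - a *ᵥ ((f * a).adjugate *ᵥ (f *ᵥ x))

section kernelVector

variable {ι : Type*} [Fintype ι] [DecidableEq ι] {n : ℕ}

theorem mulVec_kernelVector (f : Matrix ι (Fin n) ℂ) (a : Matrix (Fin n) ι ℂ) (x : Fin n → ℂ) :
    f *ᵥ kernelVector f a x = 0 := by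
  rw [kernelVector, mulVec_sub, mulVec_smul, mulVec_mulVec, mulVec_mulVec, mul_adjugate,
    smul_mulVec, one_mulVec, sub_self]

theorem kernelVector_eq_self {f : Matrix ι (Fin n) ℂ} {a : Matrix (Fin n) ι ℂ} {x : Fin n → ℂ}
    (ha : f * a = 1) (hx : f *ᵥ x = 0) : kernelVector f a x = x := by
  simp [kernelVector, ha, hx]

theorem differentiable_det {X : Type*} [NormedAddCommGroup X] [NormedSpace ℂ X]
    {A : X → Matrix ι ι ℂ} (hA : ∀ i j, Differentiable ℂ fun x => A x i j) :
    Differentiable ℂ fun x => (A x).det := by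
  simp only [det_apply]
  fun_prop

theorem differentiable_kernelVector {X : Type*} [NormedAddCommGroup X] [NormedSpace ℂ X]
    {f : X → Matrix ι (Fin n) ℂ} {a : X → Matrix (Fin n) ι ℂ} {x : X → Fin n → ℂ}
    (hf : ∀ i j, Differentiable ℂ fun z => f z i j) (ha : ∀ i j, Differentiable ℂ fun z => a z i j)
    (hx : ∀ i, Differentiable ℂ fun z => x z i) (k : Fin n) :
    Differentiable ℂ fun z => kernelVector (f z) (a z) (x z) k := by
  have hfa : ∀ i j, Differentiable ℂ fun z => (f z * a z) i j := fun i j => by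
    simp only [mul_apply]
    fun_prop
  have hdet := differentiable_det hfa
  have hadj : ∀ i j, Differentiable ℂ fun z => (f z * a z).adjugate i j := fun i j => by
    simp only [adjugate_apply]
    refine differentiable_det fun k l => ?_
    by_cases h : k = j
    · subst h; simp
    · simpa [updateRow_ne h] using hfa k l
  simp only [kernelVector, Pi.sub_apply, Pi.smul_apply, smul_eq_mul, mulVec, dotProduct]
  fun_prop

/-- A vector killed by linearly independent functionals can follow small movements of these
functionals. -/
theorem exists_tendsto_kernel {F : ℂ → Matrix ι (Fin n) ℂ}
    (hF : ∀ i j, Differentiable ℂ fun t => F t i j) (hind : LinearIndependent ℂ (F 0))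
    {x : Fin n → ℂ} (hx : F 0 *ᵥ x = 0) :
    ∃ y : ℂ → Fin n → ℂ, Continuous y ∧ y 0 = x ∧ ∀ t, F t *ᵥ y t = 0 := by
  obtain ⟨a, ha⟩ := exists_mul_eq_one hind
  refine ⟨fun t => kernelVector (F t) a x, ?_, kernelVector_eq_self ha hx,
    fun t => mulVec_kernelVector _ _ _⟩
  exact continuous_pi fun k => (differentiable_kernelVector hF (fun i j => by fun_prop)
    (fun i => by fun_prop) k).continuous

end kernelVector

/-! ### Density -/

/-- The nonvanishing locus of an entire function that is not identically zero is dense. -/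
theorem dense_ne_zero_of_differentiable {X : Type*} [NormedAddCommGroup X] [NormedSpace ℂ X]
    {g : X → ℂ} (hg : Differentiable ℂ g) {x₁ : X} (h₁ : g x₁ ≠ 0) : Dense {x | g x ≠ 0} := by
  intro x₀
  by_contra hx
  have hev : ∀ᶠ x in 𝓝 x₀, g x = 0 := by
    filter_upwards [isClosed_closure.isOpen_compl.mem_nhds hx] with x hx'
    by_contra h
    exact hx' (subset_closure h)
  let h : ℂ → ℂ := fun t => g (x₀ + t • (x₁ - x₀))
  have hh : Differentiable ℂ h := by fun_prop
  have htend : Filter.Tendsto (fun t : ℂ => x₀ + t • (x₁ - x₀)) (𝓝 0) (𝓝 x₀) := by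
    have : Continuous fun t : ℂ => x₀ + t • (x₁ - x₀) := by fun_prop
    simpa using this.tendsto 0
  have h0 : h =ᶠ[𝓝 0] 0 := htend.eventually hev
  have := AnalyticOnNhd.eqOn_zero_of_preconnected_of_eventuallyEq_zero
    (fun z _ => hh.analyticAt z) isPreconnected_univ (Set.mem_univ 0) h0 (Set.mem_univ 1)
  simp [h] at this
  exact h₁ this

/-- A vector of `W` is a limit of vectors of `W` that avoid finitely many subspaces, none of which
contains `W`. -/
theorem exists_near_notMem {F : Type*} [NormedAddCommGroup F] [NormedSpace ℂ F]
    [FiniteDimensional ℂ F] {W : Submodule ℂ F} {K : Set (Submodule ℂ F)} (hK : K.Finite)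
    (hWK : ∀ A ∈ K, ¬ W ≤ A) {x : F} (hx : x ∈ W) {N : Set F} (hN : N ∈ 𝓝 x) :
    ∃ y ∈ N, y ∈ W ∧ ∀ A ∈ K, y ∉ A := by
  have hd : Dense (⋂ A ∈ K, {w : W | (w : F) ∉ A}) := by
    have hcl : ∀ A : Submodule ℂ F, IsClosed {w : W | (w : F) ∈ A} := fun A =>
      (A.closed_of_finiteDimensional).preimage continuous_subtype_val
    refine dense_biInter_of_isOpen (fun A _ => (hcl A).isOpen_compl) hK.countable fun A hA => ?_
    change Dense {w : W | (w : F) ∈ A}ᶜ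
    rw [← interior_eq_empty_iff_dense_compl]
    by_contra hne
    refine hWK A hA (Submodule.comap_subtype_eq_top.1 ?_)
    exact (A.comap W.subtype).eq_top_of_nonempty_interior' (Set.nonempty_iff_ne_empty.2 hne)
  have hN' : {w : W | (w : F) ∈ N} ∈ 𝓝 (⟨x, hx⟩ : W) := continuous_subtype_val.continuousAt hN
  obtain ⟨w, hwN, hw⟩ := mem_closure_iff_nhds.1 (hd ⟨x, hx⟩) _ hN'
  exact ⟨w, hwN, w.2, fun A hA => Set.mem_iInter₂.1 hw A hA⟩

/-- A family of at most `dim W` vectors of `W` is a limit of linearly independent families of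
vectors of `W`, each of which avoids finitely many subspaces not containing `W`. -/
theorem exists_near_linearIndepOn {E F : Type*} [Finite E] [NormedAddCommGroup F] [NormedSpace ℂ F]
    [FiniteDimensional ℂ F] (W : Submodule ℂ F) (K : E → Set (Submodule ℂ F))
    (hK : ∀ p, (K p).Finite) (P : Finset E) (hWK : ∀ p ∈ P, ∀ A ∈ K p, ¬ W ≤ A)
    (hP : P.card ≤ Module.finrank ℂ W) (x : E → F) (hx : ∀ p ∈ P, x p ∈ W) (U : Set (E → F))
    (hU : U ∈ 𝓝 x) :
    ∃ y ∈ U, (∀ p ∉ P, y p = x p) ∧ (∀ p ∈ P, y p ∈ W ∧ ∀ A ∈ K p, y p ∉ A) ∧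
      LinearIndepOn ℂ y P := by
  classical
  obtain ⟨V, hVU, hVo, hxV⟩ := mem_nhds_iff.1 hU
  suffices ∃ y ∈ V, (∀ p ∉ P, y p = x p) ∧ (∀ p ∈ P, y p ∈ W ∧ ∀ A ∈ K p, y p ∉ A) ∧
      LinearIndepOn ℂ y P from
    let ⟨y, hy, h⟩ := this
    ⟨y, hVU hy, h⟩
  clear hVU
  induction P using Finset.induction_on with
  | empty => exact ⟨x, hxV, by simp⟩
  | insert p P hp ih =>
    rw [Finset.card_insert_of_notMem hp] at hP
    obtain ⟨y, hyV, hyx, hyW, hyi⟩ := ih (fun q hq => hWK q (Finset.mem_insert_of_mem hq))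
      (by omega) (fun q hq => hx q (Finset.mem_insert_of_mem hq))
    have hspan : ¬ W ≤ Submodule.span ℂ (y '' P) := fun hle => by
      have h1 := Submodule.finrank_mono hle
      have h2 := finrank_span_finset_le_card (R := ℂ) (P.image y)
      have h3 : (P.image y).card ≤ P.card := Finset.card_image_le
      rw [Finset.coe_image, Set.finrank] at h2
      omega
    have hcont : ContinuousAt (fun z => Function.update y p z) (y p) := by fun_prop
    obtain ⟨z, hzV, hzW, hz⟩ := exists_near_notMem
      (W := W) (K := insert (Submodule.span ℂ (y '' P)) (K p)) ((hK p).insert _)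
      (by
        rintro A (rfl | hA)
        · exact hspan
        · exact hWK p (Finset.mem_insert_self _ _) A hA)
      (x := y p) (by rw [hyx p hp]; exact hx p (Finset.mem_insert_self _ _))
      (hcont.preimage_mem_nhds (t := V)
        (by rw [Function.update_eq_self]; exact hVo.mem_nhds hyV))
    have hne : ∀ q ∈ P, Function.update y p z q = y q := fun q hq =>
      Function.update_of_ne (by rintro rfl; exact hp hq) _ _
    refine ⟨Function.update y p z, hzV, fun q hq => ?_, fun q hq => ?_, ?_⟩
    · rw [Finset.mem_insert, not_or] at hq
      rw [Function.update_of_ne hq.1, hyx q hq.2]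
    · rcases Finset.mem_insert.1 hq with rfl | hq
      · rw [Function.update_self]
        exact ⟨hzW, fun A hA => hz A (Or.inr hA)⟩
      · rw [hne q hq]
        exact hyW q hq
    · rw [Finset.coe_insert, linearIndepOn_insert (by simpa using hp)]
      refine ⟨hyi.congr fun q hq => (hne q hq).symm, ?_⟩
      rw [Function.update_self, Set.image_congr hne]
      exact hz _ (Or.inl rfl)

/-! ### Separating the hyperplanes -/

/-- The combinatorial hypotheses on a family `V` of hyperplanes in a finite set of points `E`, where
`inc v p` says that the point `p` lies on the hyperplane `v`: at most two hyperplanes pass through a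
point, two hyperplanes share at most `n - 2` points, and every nonempty set `T` of hyperplanes has a
member that meets the other members of `T` in at most `n - 1` points. Sizes are bounded through
finite subsets. -/
structure IsSparseIncidence {V E : Type*} (inc : V → E → Prop) (n : ℕ) : Prop where
  eq_of_inc : ∀ p u v w, inc u p → inc v p → inc w p → u = v ∨ u = w ∨ v = w
  card_inter : ∀ v w, v ≠ w → ∀ s : Finset E, (∀ p ∈ s, inc v p ∧ inc w p) → s.card + 2 ≤ n
  degenerate : ∀ T : Finset V, T.Nonempty → ∃ v ∈ T, ∀ s : Finset E,
    (∀ p ∈ s, inc v p ∧ ∃ w ∈ T, w ≠ v ∧ inc w p) → s.card + 1 ≤ n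

/-- The vectors `γ` lie on the linear hyperplanes with normal vectors `φ`, as prescribed by the
incidence relation. -/
def IsCompat {V E : Type*} {n : ℕ} (inc : V → E → Prop) (φ : V → Fin n → ℂ)
    (γ : E → Fin n → ℂ) : Prop :=
  ∀ v p, inc v p → φ v ⬝ᵥ γ p = 0

/-- The hyperplane orthogonal to `φ`. -/
noncomputable def orthogonal {n : ℕ} (φ : Fin n → ℂ) : Submodule ℂ (Fin n → ℂ) :=
  LinearMap.ker (dotProductEquiv ℂ (Fin n) φ)

theorem mem_orthogonal {n : ℕ} {φ x : Fin n → ℂ} : x ∈ orthogonal φ ↔ φ ⬝ᵥ x = 0 := Iff.rfl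

theorem finrank_orthogonal {n : ℕ} {φ : Fin n → ℂ} (hφ : φ ≠ 0) :
    Module.finrank ℂ (orthogonal φ) + 1 = n := by
  have h := Module.Dual.finrank_ker_add_one_of_ne_zero (f := dotProductEquiv ℂ (Fin n) φ)
    (by simpa using hφ)
  rw [Module.finrank_fin_fun] at h
  exact h

/-- Functionals with prescribed values at independent vectors of `W`; if these do not span `W`, the
functional can be made to differ on `W` from each of finitely many given ones. -/
theorem exists_functional_separated {V E : Type*} [Finite V] {n : ℕ}
    (W : Submodule ℂ (Fin n → ℂ)) {y : E → Fin n → ℂ} {P : Finset E} (hy : LinearIndepOn ℂ y P)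
    (c : E → ℂ) (ψ : V → Fin n → ℂ) :
    ∃ χ : Fin n → ℂ, (∀ p ∈ P, χ ⬝ᵥ y p = c p) ∧
      (P.card < Module.finrank ℂ W → ∃ u ∈ W, ∀ w, χ ⬝ᵥ u ≠ ψ w ⬝ᵥ u) := by
  classical
  cases nonempty_fintype V
  by_cases hP : P.card < Module.finrank ℂ W
  · obtain ⟨u, huW, hu⟩ : ∃ u ∈ W, u ∉ Submodule.span ℂ (y '' P) := by
      by_contra! hle
      have h1 := Submodule.finrank_mono (show W ≤ _ from hle)
      have h2 := finrank_span_finset_le_card (R := ℂ) (P.image y)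
      have h3 : (P.image y).card ≤ P.card := Finset.card_image_le
      rw [Finset.coe_image, Set.finrank] at h2
      omega
    obtain ⟨c₀, hc₀⟩ := Infinite.exists_notMem_finset (Finset.univ.image fun w : V => ψ w ⬝ᵥ u)
    have hopt : LinearIndependent ℂ (fun o : Option P => o.elim u fun p => y p) := by
      refine linearIndependent_option.2 ⟨hy, ?_⟩
      rw [Set.image_eq_range] at hu
      exact hu
    obtain ⟨χ, hχ⟩ := exists_dotProduct_eq hopt (fun o => o.elim c₀ fun p => c p)
    refine ⟨χ, fun p hp => by rw [dotProduct_comm]; exact hχ (some ⟨p, hp⟩), fun _ =>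
      ⟨u, huW, fun w hw => hc₀ ?_⟩⟩
    have := hχ none
    rw [dotProduct_comm] at this
    exact Finset.mem_image.2 ⟨w, Finset.mem_univ _, hw.symm.trans this⟩
  · obtain ⟨χ, hχ⟩ := exists_dotProduct_eq hy (fun p => c p)
    exact ⟨χ, fun p hp => by rw [dotProduct_comm]; exact hχ ⟨p, hp⟩, fun h => absurd h hP⟩

/-- After a small generic movement of the vectors `γ` inside the fixed hyperplanes, coinciding
hyperplanes can be pulled apart to first order: there are velocities `ψ` of the normal vectors such
that every point on two coinciding hyperplanes stays on both to first order, while the two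
hyperplanes separate. The hyperplanes are treated one by one, in an order in which each has at
most `n - 1` points in common with the earlier ones; the values of its velocity at those points are
forced by the earlier velocities. -/
theorem exists_separating_velocities {V E : Type*} [Finite V] [Finite E] {n : ℕ}
    {inc : V → E → Prop} (hinc : IsSparseIncidence inc n) {φ : V → Fin n → ℂ} (hφ : ∀ v, φ v ≠ 0)
    (T : Finset V) {γ : E → Fin n → ℂ} (hγ : IsCompat inc φ γ) {U : Set (E → Fin n → ℂ)}
    (hU : U ∈ 𝓝 γ) :
    ∃ y ∈ interior U, IsCompat inc φ y ∧ ∃ ψ : V → Fin n → ℂ,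
      ∀ v ∈ T, ∀ w ∈ T, v ≠ w → φ v = φ w →
        (∀ p, inc v p → inc w p → ψ v ⬝ᵥ y p = ψ w ⬝ᵥ y p) ∧
        ∃ u, φ v ⬝ᵥ u = 0 ∧ ψ v ⬝ᵥ u ≠ ψ w ⬝ᵥ u := by
  classical
  cases nonempty_fintype E
  induction T using Finset.strongInduction with
  | H T ih =>
  rcases T.eq_empty_or_nonempty with rfl | hT
  · exact ⟨γ, mem_interior_iff_mem_nhds.2 hU, hγ, 0, by simp⟩
  obtain ⟨v, hvT, hv⟩ := hinc.degenerate T hT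
  obtain ⟨x, hxU, hx, ψ, hψ⟩ := ih (T.erase v) (Finset.erase_ssubset hvT)
  -- the points of `v` on earlier hyperplanes that coincide with `v`
  let P : Finset E := {p | inc v p ∧ ∃ w ∈ T.erase v, inc w p ∧ φ w = φ v}
  have hPmem : ∀ p, p ∈ P ↔ inc v p ∧ ∃ w ∈ T.erase v, inc w p ∧ φ w = φ v := by simp [P]
  have hPcard : P.card + 1 ≤ n := hv P fun p hp => by
    obtain ⟨h1, w, hw, h2, -⟩ := (hPmem p).1 hp
    exact ⟨h1, w, Finset.mem_of_mem_erase hw, Finset.ne_of_mem_erase hw, h2⟩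
  have hW := finrank_orthogonal (hφ v)
  have hother : ∀ p, ∃ w, p ∈ P → w ∈ T.erase v ∧ inc w p ∧ φ w = φ v := fun p => by
    by_cases hp : p ∈ P
    · obtain ⟨-, w, h⟩ := (hPmem p).1 hp
      exact ⟨w, fun _ => h⟩
    · exact ⟨v, fun h => absurd h hp⟩
  choose o ho using hother
  have huniq : ∀ p ∈ P, ∀ w, inc w p → w ≠ v → w = o p := fun p hp w hw hwv => by
    rcases hinc.eq_of_inc p w (o p) v hw (ho p hp).2.1 ((hPmem p).1 hp).1 with h | h | h
    · exact h
    · exact absurd h hwv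
    · exact absurd h (Finset.ne_of_mem_erase (ho p hp).1)
  -- at a new position outside these subspaces, the velocity forced on `v` by the point `p` differs
  -- from that of every earlier hyperplane not containing `p`
  let K : E → Set (Submodule ℂ (Fin n → ℂ)) := fun p =>
    {A | ∃ w, (w ∈ T.erase v ∧ φ w = φ v ∧ w ≠ o p) ∧ orthogonal (ψ w - ψ (o p)) = A}
  obtain ⟨y, hyU, hyx, hyW, hyind⟩ := exists_near_linearIndepOn (orthogonal (φ v)) K
    (fun p => (Set.toFinite {w | w ∈ T.erase v ∧ φ w = φ v ∧ w ≠ o p}).image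
      (fun w => orthogonal (ψ w - ψ (o p)))) P
    (by
      rintro p hp A ⟨w, ⟨hwT, hwv, hwo⟩, rfl⟩ hle
      obtain ⟨-, u, hu, hne⟩ := hψ w hwT (o p) (ho p hp).1 hwo (hwv.trans (ho p hp).2.2.symm)
      have := mem_orthogonal.1 (hle (mem_orthogonal.2 (hwv ▸ hu)))
      rw [sub_dotProduct, sub_eq_zero] at this
      exact hne this)
    (by omega) x (fun p hp => mem_orthogonal.2 (hx v p ((hPmem p).1 hp).1)) (interior U)
    (isOpen_interior.mem_nhds hxU)
  obtain ⟨χ, hχ, hχu⟩ := exists_functional_separated (orthogonal (φ v)) hyind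
    (fun p => ψ (o p) ⬝ᵥ y p) ψ
  refine ⟨y, hyU, fun w p hwp => ?_, Function.update ψ v χ, ?_⟩
  · by_cases hp : p ∈ P
    · have hy0 := mem_orthogonal.1 (hyW p hp).1
      by_cases hwv : w = v
      · rwa [hwv]
      · rwa [huniq p hp w hwp hwv, (ho p hp).2.2]
    · rw [hyx p hp]
      exact hx w p hwp
  have hnew : ∀ w ∈ T.erase v, φ v = φ w →
      (∀ p, inc v p → inc w p → χ ⬝ᵥ y p = ψ w ⬝ᵥ y p) ∧
        ∃ u, φ v ⬝ᵥ u = 0 ∧ χ ⬝ᵥ u ≠ ψ w ⬝ᵥ u := by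
    intro w hw hvw
    refine ⟨fun p hvp hwp => ?_, ?_⟩
    · have hp : p ∈ P := (hPmem p).2 ⟨hvp, w, hw, hwp, hvw.symm⟩
      rw [hχ p hp, huniq p hp w hwp (Finset.ne_of_mem_erase hw)]
    · -- if all of `P` lies on `w`, there are at most `n - 2` conditions, so `χ` is not determined
      by_cases hall : ∀ p ∈ P, inc w p
      · have := hinc.card_inter v w (Finset.ne_of_mem_erase hw).symm P
          fun p hp => ⟨((hPmem p).1 hp).1, hall p hp⟩
        obtain ⟨u, hu, h⟩ := hχu (by omega)
        exact ⟨u, hu, h w⟩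
      · push Not at hall
        obtain ⟨p, hp, hwp⟩ := hall
        refine ⟨y p, (hyW p hp).1, fun h => (hyW p hp).2 (orthogonal (ψ w - ψ (o p)))
          ⟨w, ⟨hw, hvw.symm, ?_⟩, rfl⟩ ?_⟩
        · rintro rfl
          exact hwp (ho p hp).2.1
        · rw [mem_orthogonal, sub_dotProduct, sub_eq_zero, ← h, hχ p hp]
  intro a ha b hb hab hφab
  by_cases hav : a = v
  · subst hav
    rw [Function.update_self, Function.update_of_ne hab.symm]
    exact hnew b (Finset.mem_erase.2 ⟨hab.symm, hb⟩) hφab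
  by_cases hbv : b = v
  · subst hbv
    rw [Function.update_self, Function.update_of_ne hab]
    obtain ⟨h1, u, hu, h2⟩ := hnew a (Finset.mem_erase.2 ⟨hab, ha⟩) hφab.symm
    exact ⟨fun p hap hbp => (h1 p hbp hap).symm, u, hφab ▸ hu, h2.symm⟩
  rw [Function.update_of_ne hav, Function.update_of_ne hbv]
  obtain ⟨h1, h2⟩ := hψ a (Finset.mem_erase.2 ⟨hav, ha⟩) b (Finset.mem_erase.2 ⟨hbv, hb⟩) hab hφab
  refine ⟨fun p hap hbp => ?_, h2⟩
  have hp : p ∉ P := fun hp =>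
    hab ((huniq p hp a hap hav).trans (huniq p hp b hbp hbv).symm)
  rw [hyx p hp]
  exact h1 p hap hbp

/-- The configurations of vectors lying on pairwise distinct hyperplanes, as prescribed by the
incidence relation. -/
def distinctLocus {V E : Type*} (inc : V → E → Prop) (n : ℕ) : Set (E → Fin n → ℂ) :=
  {γ | ∃ φ : V → Fin n → ℂ, (∀ v, φ v ≠ 0) ∧
    (∀ v w, v ≠ w → LinearIndependent ℂ ![φ v, φ w]) ∧ IsCompat inc φ γ}

theorem linearIndependent_of_eq_of_inc {V E : Type*} {inc : V → E → Prop} {n : ℕ}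
    (hinc : IsSparseIncidence inc n) {φ : V → Fin n → ℂ} (hφ : ∀ v, φ v ≠ 0) (p : E)
    (hpair : ∀ v w, v ≠ w → inc v p → inc w p → LinearIndependent ℂ ![φ v, φ w]) :
    LinearIndependent ℂ fun v : {v // inc v p} => φ v := by
  classical
  by_cases h : ∃ v w, v ≠ w ∧ inc v p ∧ inc w p
  · obtain ⟨v, w, hvw, hv, hw⟩ := h
    let e : Fin 2 ≃ {v // inc v p} := Equiv.ofBijective ![⟨v, hv⟩, ⟨w, hw⟩] (by
      constructor
      · intro i j hij
        fin_cases i <;> fin_cases j <;> simp_all [eq_comm]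
      · rintro ⟨u, hu⟩
        rcases hinc.eq_of_inc p u v w hu hv hw with rfl | rfl | h
        · exact ⟨0, rfl⟩
        · exact ⟨1, rfl⟩
        · exact absurd h hvw)
    rw [← linearIndependent_equiv e]
    convert hpair v w hvw hv hw using 1
    ext i
    fin_cases i <;> rfl
  · push Not at h
    have : Subsingleton {v // inc v p} :=
      ⟨fun a b => Subtype.ext (by_contra fun hab => h a b hab a.2 b.2)⟩
    rcases isEmpty_or_nonempty {v // inc v p} with _ | ⟨⟨i⟩⟩
    · exact linearIndependent_empty_type
    · exact LinearIndependent.of_subsingleton i (hφ i)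

/-- Each point can follow the hyperplanes through it along `φ + t ψ`. -/
theorem exists_curve_point {V E : Type*} [Finite V] {inc : V → E → Prop} {n : ℕ}
    (hinc : IsSparseIncidence inc n) {φ ψ : V → Fin n → ℂ} (hφ : ∀ v, φ v ≠ 0)
    (hpar : ∀ v w, φ v ≠ φ w → LinearIndependent ℂ ![φ v, φ w])
    (hsep : ∀ v w, v ≠ w → φ v = φ w → LinearIndependent ℂ ![φ v, ψ w - ψ v]) {p : E}
    {x : Fin n → ℂ} (hx : ∀ v, inc v p → φ v ⬝ᵥ x = 0)
    (hψ : ∀ v w, v ≠ w → φ v = φ w → inc v p → inc w p → ψ v ⬝ᵥ x = ψ w ⬝ᵥ x) :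
    ∃ y : ℂ → Fin n → ℂ, Continuous y ∧ y 0 = x ∧
      ∀ t v, inc v p → (φ v + t • ψ v) ⬝ᵥ y t = 0 := by
  classical
  cases nonempty_fintype V
  by_cases h : ∃ v w, v ≠ w ∧ inc v p ∧ inc w p ∧ φ v = φ w
  · -- here the two functionals are replaced by the first one and their difference divided by `t`
    obtain ⟨v, w, hvw, hv, hw, hφvw⟩ := h
    obtain ⟨y, hyc, hy0, hy⟩ := exists_tendsto_kernel
      (F := fun t => ![φ v + t • ψ v, ψ w - ψ v]) (x := x)
      (by
        intro i j
        fin_cases i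
        · simp only [Pi.add_apply, Pi.smul_apply, Fin.zero_eta, cons_val_zero]
          fun_prop
        · simp)
      (by simpa using hsep v w hvw hφvw)
      (by
        ext i
        fin_cases i
        · simpa [mulVec] using hx v hv
        · change (ψ w - ψ v) ⬝ᵥ x = 0
          rw [sub_dotProduct, hψ v w hvw hφvw hv hw, sub_self])
    refine ⟨y, hyc, hy0, fun t u hu => ?_⟩
    have h0 : (φ v + t • ψ v) ⬝ᵥ y t = 0 := congrFun (hy t) 0
    have h1 : (ψ w - ψ v) ⬝ᵥ y t = 0 := congrFun (hy t) 1
    rcases hinc.eq_of_inc p u v w hu hv hw with rfl | rfl | h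
    · exact h0
    · have : φ u + t • ψ u = (φ v + t • ψ v) + t • (ψ u - ψ v) := by
        rw [hφvw, smul_sub]
        abel
      rw [this, add_dotProduct, h0, smul_dotProduct, h1, smul_zero, add_zero]
    · exact absurd h hvw
  · push Not at h
    obtain ⟨y, hyc, hy0, hy⟩ := exists_tendsto_kernel
      (F := fun t (v : {v // inc v p}) => φ v + t • ψ v) (x := x)
      (by
        intro i j
        simp only [Pi.add_apply, Pi.smul_apply]
        fun_prop)
      (by
        simpa using linearIndependent_of_eq_of_inc hinc hφ p
          fun v w hvw hv hw => hpar v w (h v w hvw hv hw))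
      (by
        ext v
        simpa [mulVec] using hx v v.2)
    exact ⟨y, hyc, hy0, fun t v hv => congrFun (hy t) ⟨v, hv⟩⟩

theorem eventually_linearIndependent_pair {n : ℕ} {f g : ℂ → Fin n → ℂ} (hf : Continuous f)
    (hg : Continuous g) (h : LinearIndependent ℂ ![f 0, g 0]) :
    ∀ᶠ t in 𝓝 0, LinearIndependent ℂ ![f t, g t] := by
  have hc : Continuous fun t => ![f t, g t] := by
    refine continuous_pi fun i => ?_
    fin_cases i
    · exact hf
    · exact hg
  exact (hc.tendsto 0).eventually h.eventually

/-- Pulling coinciding hyperplanes apart shows that every configuration of vectors lying on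
hyperplanes is a limit of configurations lying on pairwise distinct hyperplanes. -/
theorem mem_closure_distinctLocus {V E : Type*} [Finite V] [Finite E] {inc : V → E → Prop} {n : ℕ}
    (hinc : IsSparseIncidence inc n) {γ : E → Fin n → ℂ}
    (hγ : ∀ v, ∃ φ : Fin n → ℂ, φ ≠ 0 ∧ ∀ p, inc v p → φ ⬝ᵥ γ p = 0) :
    γ ∈ closure (distinctLocus inc n) := by
  choose φ₀ hφ₀ hγ₀ using hγ
  -- proportional normal vectors are replaced by equal ones
  let φ : V → Fin n → ℂ := fun v => (Projectivization.mk ℂ (φ₀ v) (hφ₀ v)).rep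
  have hφ : ∀ v, φ v ≠ 0 := fun v => Projectivization.rep_nonzero _
  have hpar : ∀ v w, φ v ≠ φ w → LinearIndependent ℂ ![φ v, φ w] := fun v w h => by
    rw [← Projectivization.independent_mk_iff_LinearIndependent (hφ v) (hφ w),
      Projectivization.independent_pair_iff_ne, Projectivization.mk_rep, Projectivization.mk_rep]
    exact fun he => h (congrArg Projectivization.rep he)
  have hcompat : IsCompat inc φ γ := fun v p hp => by
    obtain ⟨a, ha⟩ := Projectivization.exists_smul_eq_mk_rep ℂ (φ₀ v) (hφ₀ v)
    change (Projectivization.mk ℂ (φ₀ v) (hφ₀ v)).rep ⬝ᵥ γ p = 0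
    rw [← ha, smul_dotProduct, hγ₀ v p hp, smul_zero]
  rw [← closure_closure, mem_closure_iff_nhds]
  intro U hU
  cases nonempty_fintype V
  obtain ⟨x, hxU, hx, ψ, hψ⟩ := exists_separating_velocities hinc hφ Finset.univ hcompat hU
  refine ⟨x, interior_subset hxU, ?_⟩
  have hsep : ∀ v w, v ≠ w → φ v = φ w → LinearIndependent ℂ ![φ v, ψ w - ψ v] := by
    intro v w hvw hφvw
    obtain ⟨-, u, hu, hne⟩ := hψ v (Finset.mem_univ _) w (Finset.mem_univ _) hvw hφvw
    rw [LinearIndependent.pair_iff]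
    intro s t hst
    have ht : t = 0 := by
      have h := congrArg (· ⬝ᵥ u) hst
      simp only [add_dotProduct, smul_dotProduct, sub_dotProduct, hu, zero_dotProduct,
        smul_eq_mul, mul_zero, zero_add, mul_eq_zero, sub_eq_zero] at h
      exact h.resolve_right hne.symm
    refine ⟨?_, ht⟩
    rw [ht, zero_smul, add_zero] at hst
    exact (smul_eq_zero.1 hst).resolve_right (hφ v)
  choose y hyc hy0 hy using fun p => exists_curve_point hinc hφ hpar hsep
    (fun v hv => hx v p hv) (fun v w hvw hφvw hv hw =>
      (hψ v (Finset.mem_univ _) w (Finset.mem_univ _) hvw hφvw).1 p hv hw)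
  have hlim : Filter.Tendsto (fun t p => y p t) (𝓝[≠] 0) (𝓝 x) := by
    have : Filter.Tendsto (fun t p => y p t) (𝓝 0) (𝓝 x) := by
      rw [tendsto_pi_nhds]
      intro p
      rw [← hy0 p]
      exact (hyc p).tendsto 0
    exact this.mono_left nhdsWithin_le_nhds
  refine mem_closure_of_tendsto hlim ?_
  have hnz : ∀ᶠ t in 𝓝 (0 : ℂ), ∀ v, φ v + t • ψ v ≠ 0 := Filter.eventually_all.2 fun v => by
    have hc : Continuous fun t : ℂ => φ v + t • ψ v := by fun_prop
    exact (hc.tendsto 0).eventually_ne (by simpa using hφ v)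
  have hind : ∀ᶠ t in 𝓝 (0 : ℂ), ∀ v w, v ≠ w → t ≠ 0 →
      LinearIndependent ℂ ![φ v + t • ψ v, φ w + t • ψ w] := by
    refine Filter.eventually_all.2 fun v => Filter.eventually_all.2 fun w => ?_
    by_cases hφvw : φ v = φ w
    · by_cases hvw : v = w
      · exact Filter.Eventually.of_forall fun t h => absurd hvw h
      have h := eventually_linearIndependent_pair (f := fun t => φ v + t • ψ v)
        (g := fun _ => ψ w - ψ v) (by fun_prop) (by fun_prop) (by simpa using hsep v w hvw hφvw)
      filter_upwards [h] with t ht _ ht0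
      rw [LinearIndependent.pair_iff] at ht ⊢
      intro a b hab
      obtain ⟨h1, h2⟩ := ht (a + b) (b * t) (by
        rw [← hab, ← hφvw]
        module)
      have hb : b = 0 := (mul_eq_zero.1 h2).resolve_right ht0
      exact ⟨by rw [hb, add_zero] at h1; exact h1, hb⟩
    · have h := eventually_linearIndependent_pair (f := fun t => φ v + t • ψ v)
        (g := fun t => φ w + t • ψ w) (by fun_prop) (by fun_prop) (by simpa using hpar v w hφvw)
      filter_upwards [h] with t ht _ _ using ht
  filter_upwards [nhdsWithin_le_nhds hnz, nhdsWithin_le_nhds hind, self_mem_nhdsWithin]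
    with t h1 h2 h3
  exact ⟨fun v => φ v + t • ψ v, h1, fun v w hvw => h2 v w hvw h3, fun v p hp => hy p t v hp⟩

/-! ### Generic configurations on distinct hyperplanes -/

/-- The configurations of vectors lying on hyperplanes as prescribed by the incidence relation, such
that any `n` of them that are not prescribed to lie on a common hyperplane form a basis. -/
def genericLocus {V E : Type*} (inc : V → E → Prop) (n : ℕ) : Set (E → Fin n → ℂ) :=
  {γ | (∀ v, ∃ φ : Fin n → ℂ, φ ≠ 0 ∧ ∀ p, inc v p → φ ⬝ᵥ γ p = 0) ∧
    ∀ B : Fin n ↪ E, (∀ v, ∃ i, ¬ inc v (B i)) → LinearIndependent ℂ fun i => γ (B i)}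

/-- The parameter space of the configurations: normal vectors of the hyperplanes, and the two
auxiliary arguments of `kernelVector` for each point. -/
abbrev ConfigParam (V E : Type*) (n : ℕ) : Type _ :=
  (V → Fin n → ℂ) × (E → Fin n → V → ℂ) × (E → Fin n → ℂ)

open Classical in
/-- The configuration with given parameters. It always lies on the hyperplanes with the given normal
vectors. -/
noncomputable def config {V E : Type*} [Fintype V] {n : ℕ} (inc : V → E → Prop)
    (θ : ConfigParam V E n) (p : E) : Fin n → ℂ :=
  kernelVector (ι := {v // inc v p}) (fun v => θ.1 v) (fun k v => θ.2.1 p k v) (θ.2.2 p)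

section config

variable {V E : Type*} [Fintype V] {n : ℕ} {inc : V → E → Prop}

theorem isCompat_config (θ : ConfigParam V E n) : IsCompat inc θ.1 (config inc θ) :=
  fun v p hp => by
    classical
    have h : (fun v : {v // inc v p} => θ.1 v) *ᵥ config inc θ p = 0 := mulVec_kernelVector _ _ _
    exact congrFun h ⟨v, hp⟩

theorem differentiable_config [Fintype E] (p : E) (k : Fin n) :
    Differentiable ℂ fun θ : ConfigParam V E n => config inc θ p k := by
  classical
  refine differentiable_kernelVector (fun i j => ?_) (fun i j => ?_) (fun i => ?_) k <;> fun_prop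

theorem exists_config_eq {φ : V → Fin n → ℂ} {γ : E → Fin n → ℂ} (S : Set E)
    (hγ : ∀ p ∈ S, ∀ v, inc v p → φ v ⬝ᵥ γ p = 0)
    (hφ : ∀ p ∈ S, LinearIndependent ℂ fun v : {v // inc v p} => φ v) :
    ∃ θ : ConfigParam V E n, θ.1 = φ ∧ ∀ p ∈ S, config inc θ p = γ p := by
  classical
  have hex : ∀ p, ∃ a : Matrix (Fin n) {v // inc v p} ℂ, p ∈ S →
      Matrix.of (fun v : {v // inc v p} => φ v) * a = 1 := fun p => by
    by_cases hp : p ∈ S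
    · obtain ⟨a, ha⟩ := exists_mul_eq_one (f := Matrix.of _) (hφ p hp)
      exact ⟨a, fun _ => ha⟩
    · exact ⟨0, fun h => absurd h hp⟩
  choose a ha using hex
  refine ⟨(φ, fun p k v => if h : inc v p then a p k ⟨v, h⟩ else 0, γ), rfl, fun p hp => ?_⟩
  have hrestrict : (fun (k : Fin n) (v : {v // inc v p}) =>
      if h : inc v.1 p then a p k ⟨v.1, h⟩ else 0) = a p := by
    ext k v
    rw [dif_pos v.2]
  unfold config
  dsimp only
  rw [hrestrict]
  refine kernelVector_eq_self (ha p hp) ?_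
  ext v
  exact hγ p hp v v.2

end config

/-- When the standard basis vectors are placed at the points `B i`, a hyperplane passes through the
prescribed ones among them if its normal vector vanishes at the corresponding coordinates. The other
coordinates can be chosen such that distinct hyperplanes have independent normal vectors: every
normal vector keeps a nonzero coordinate because `B` lies on no hyperplane, and two of them together
keep at least two because two hyperplanes share at most `n - 2` points. -/
theorem exists_normals_of_basis {V E : Type*} [Fintype V] {n : ℕ} {inc : V → E → Prop}
    (hinc : IsSparseIncidence inc n) (B : Fin n ↪ E) (hB : ∀ v, ∃ i, ¬ inc v (B i)) :
    ∃ φ : V → Fin n → ℂ, (∀ v i, inc v (B i) → φ v i = 0) ∧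
      (∀ v, φ v ≠ 0) ∧ ∀ v w, v ≠ w → LinearIndependent ℂ ![φ v, φ w] := by
  classical
  let s : V → ℕ := fun v => Fintype.equivFin V v
  have hs : Function.Injective s := fun v w h =>
    (Fintype.equivFin V).injective (Fin.val_injective h)
  -- `(s v + i) + 1` is never zero, and its `2 × 2` minors are `± (s v - s w) * (i - j)`
  let φ : V → Fin n → ℂ := fun v i => if inc v (B i) then 0 else (s v : ℂ) + i + 1
  have hφ0 : ∀ v i, inc v (B i) → φ v i = 0 := fun v i h => if_pos h
  have hφ1 : ∀ v i, ¬ inc v (B i) → φ v i = (s v : ℂ) + i + 1 := fun v i h => if_neg h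
  have hφne : ∀ v i, ¬ inc v (B i) → φ v i ≠ 0 := fun v i h => by
    rw [hφ1 v i h]
    exact_mod_cast Nat.succ_ne_zero (s v + i)
  refine ⟨φ, hφ0, fun v h => ?_, fun v w hvw => ?_⟩
  · obtain ⟨i, hi⟩ := hB v
    exact hφne v i hi (congrFun h i)
  rw [LinearIndependent.pair_iff]
  intro a b hab
  have hi : ∀ i, a * φ v i + b * φ w i = 0 := fun i => by
    simpa using congrFun hab i
  obtain ⟨iv, hiv⟩ := hB v
  obtain ⟨iw, hiw⟩ := hB w
  have hab0 : a = 0 ↔ b = 0 := by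
    constructor
    · rintro rfl
      have := hi iw
      rw [zero_mul, zero_add] at this
      exact (mul_eq_zero.1 this).resolve_right (hφne w iw hiw)
    · rintro rfl
      have := hi iv
      rw [zero_mul, add_zero] at this
      exact (mul_eq_zero.1 this).resolve_right (hφne v iv hiv)
  suffices a = 0 from ⟨this, hab0.1 this⟩
  by_cases hsame : ∀ i, inc v (B i) ↔ inc w (B i)
  · -- both normal vectors have the same support, which has at least two elements
    have hcard : 1 < (Finset.univ.filter fun i => ¬ inc v (B i)).card := by
      have h1 := hinc.card_inter v w hvw ((Finset.univ.filter fun i => inc v (B i)).map B) (by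
        intro p hp
        obtain ⟨i, hi, rfl⟩ := Finset.mem_map.1 hp
        have := (Finset.mem_filter.1 hi).2
        exact ⟨this, (hsame i).1 this⟩)
      rw [Finset.card_map] at h1
      have h2 := Finset.card_filter_add_card_filter_not (s := (Finset.univ : Finset (Fin n)))
        (fun i => inc v (B i))
      rw [Finset.card_univ, Fintype.card_fin] at h2
      omega
    obtain ⟨i, hiB, j, hjB, hij⟩ := Finset.one_lt_card.1 hcard
    replace hiB := (Finset.mem_filter.1 hiB).2
    replace hjB := (Finset.mem_filter.1 hjB).2
    have ei := hi i
    have ej := hi j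
    rw [hφ1 v i hiB, hφ1 w i (mt (hsame i).2 hiB)] at ei
    rw [hφ1 v j hjB, hφ1 w j (mt (hsame j).2 hjB)] at ej
    have hij' : (i : ℂ) - (j : ℂ) ≠ 0 := by
      rw [sub_ne_zero]
      exact_mod_cast fun h => hij (Fin.ext h)
    have hvw' : (s v : ℂ) - s w ≠ 0 := by
      rw [sub_ne_zero]
      exact_mod_cast fun h => hvw (hs h)
    have hsum : a + b = 0 := by
      have : (a + b) * ((i : ℂ) - j) = 0 := by linear_combination ei - ej
      exact (mul_eq_zero.1 this).resolve_right hij'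
    have : a * ((s v : ℂ) - s w) = 0 := by
      linear_combination ei - hsum * ((s w : ℂ) + i + 1)
    exact (mul_eq_zero.1 this).resolve_right hvw'
  · push Not at hsame
    obtain ⟨i, h | h⟩ := hsame
    · have := hi i
      rw [hφ0 v i h.1, mul_zero, zero_add] at this
      exact hab0.2 ((mul_eq_zero.1 this).resolve_right (hφne w i h.2))
    · have := hi i
      rw [hφ0 w i h.2, mul_zero, add_zero] at this
      exact (mul_eq_zero.1 this).resolve_right (hφne v i h.1)

/-- The configurations on distinct hyperplanes are parametrized by `config`, and each of the
determinants that have to be nonzero in a generic configuration is nonzero for some parameter. -/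
theorem distinctLocus_subset_closure {V E : Type*} [Finite V] [Finite E] {inc : V → E → Prop}
    {n : ℕ} (hinc : IsSparseIncidence inc n) :
    distinctLocus inc n ⊆ closure (genericLocus inc n) := by
  classical
  cases nonempty_fintype V
  cases nonempty_fintype E
  rintro γ ⟨φ, hφ, hpair, hγ⟩
  obtain ⟨θ, rfl, hθ⟩ := exists_config_eq (inc := inc) (φ := φ) (γ := γ) Set.univ
    (fun p _ v hv => hγ v p hv)
    (fun p _ => linearIndependent_of_eq_of_inc hinc hφ p fun v w hvw _ _ => hpair v w hvw)
  obtain rfl : config inc θ = γ := funext fun p => hθ p trivial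
  let g : (Fin n ↪ E) → ConfigParam V E n → ℂ := fun B θ =>
    (Matrix.of fun i => config inc θ (B i)).det
  have hg : ∀ B, Differentiable ℂ (g B) := fun B =>
    differentiable_det fun i j => differentiable_config (B i) j
  have hdense : Dense (⋂ B : {B : Fin n ↪ E // ∀ v, ∃ i, ¬ inc v (B i)}, {θ | g B θ ≠ 0}) := by
    refine dense_iInter_of_isOpen (fun B => isOpen_ne_fun (hg B).continuous continuous_const) ?_
    rintro ⟨B, hB⟩
    obtain ⟨ψ, h0, hne, hψ⟩ := exists_normals_of_basis hinc B hB
    obtain ⟨θ₁, -, h₁⟩ := exists_config_eq (inc := inc) (φ := ψ)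
      (γ := fun p k => if B k = p then 1 else 0) (Set.range B)
      (by
        rintro _ ⟨i, rfl⟩ v hv
        simpa [dotProduct] using h0 v i hv)
      (fun p _ => linearIndependent_of_eq_of_inc hinc hne p fun v w hvw _ _ => hψ v w hvw)
    refine dense_ne_zero_of_differentiable (hg B) (x₁ := θ₁) ?_
    have : (Matrix.of fun i => config inc θ₁ (B i)) = 1 := by
      ext i k
      rw [Matrix.of_apply, h₁ _ ⟨i, rfl⟩]
      simp [Matrix.one_apply, eq_comm]
    simp [g, this]
  have hcont : Continuous fun θ : ConfigParam V E n => config inc θ :=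
    continuous_pi fun p => continuous_pi fun k => (differentiable_config p k).continuous
  rw [mem_closure_iff_nhds]
  intro U hU
  have hnz : ∀ᶠ θ' : ConfigParam V E n in 𝓝 θ, ∀ v, θ'.1 v ≠ 0 :=
    Filter.eventually_all.2 fun v => by
      have hc : Continuous fun θ' : ConfigParam V E n => θ'.1 v := by fun_prop
      exact (hc.tendsto θ).eventually_ne (hφ v)
  obtain ⟨θ', ⟨h1, h2⟩, h3⟩ := mem_closure_iff_nhds.1 (hdense θ) _
    (Filter.inter_mem (hcont.continuousAt hU) hnz)
  refine ⟨config inc θ', h1, fun v => ⟨θ'.1 v, h2 v, fun p hp => isCompat_config θ' v p hp⟩,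
    fun B hB => ?_⟩
  have hdet : g B θ' ≠ 0 := Set.mem_iInter.1 h3 ⟨B, hB⟩
  exact Matrix.linearIndependent_rows_iff_isUnit.2
    ((Matrix.isUnit_iff_isUnit_det _).2 hdet.isUnit)

/-! ### Dependent hyperplanes of a paving matroid -/

/-- The dependent hyperplanes of `M`, represented as the closures of the circuits of size `n`
instead of as equivalence classes of such circuits. -/
def dependentHyperplanes {α : Type*} (M : Matroid α) (n : ℕ) : Set (Set α) :=
  {H | ∃ C, M.IsCircuit C ∧ C.encard = n ∧ M.closure C = H}

/-- The incidence relation between the dependent hyperplanes and the points of `M`. -/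
def hyperplaneInc {α : Type*} (M : Matroid α) (n : ℕ) (H : dependentHyperplanes M n) (p : M.E) :
    Prop :=
  (p : α) ∈ H.1

section paving

variable {α : Type*} {M : Matroid α} {n : ℕ}

theorem IsPaving.indep_of_encard_lt (hM : IsPaving M n) {X : Set α} (hX : X ⊆ M.E)
    (h : X.encard < n) : M.Indep X := by
  by_contra hX'
  obtain ⟨C, hCX, hC⟩ := ((M.not_indep_iff hX).1 hX').exists_isCircuit_subset
  have h1 := (Set.encard_le_encard hCX).trans_lt h
  rcases hM.2 C hC with h2 | h2
  · exact absurd h1 (by rw [h2]; exact lt_irrefl _)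
  · rw [h2] at h1
    exact absurd (le_self_add.trans_lt h1) (lt_irrefl _)

theorem IsPaving.isCircuit_of_encard_eq (hM : IsPaving M n) {X : Set α} (hX : M.Dep X)
    (h : X.encard = n) : M.IsCircuit X := by
  obtain ⟨C, hCX, hC⟩ := hX.exists_isCircuit_subset
  have hle : X.encard ≤ C.encard := by
    rcases hM.2 C hC with h2 | h2 <;> rw [h, h2]
    exact le_self_add
  have hfin : X.Finite := Set.finite_of_encard_eq_coe h
  exact (hfin.subset hCX).eq_of_subset_of_encard_le hCX hle ▸ hC

theorem subset_ground_of_mem {H : Set α} (hH : H ∈ dependentHyperplanes M n) : H ⊆ M.E := by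
  obtain ⟨C, -, -, rfl⟩ := hH
  exact M.closure_subset_ground C

theorem eRk_add_one_of_mem {H : Set α} (hH : H ∈ dependentHyperplanes M n) : M.eRk H + 1 = n := by
  obtain ⟨C, hC, hCn, rfl⟩ := hH
  rw [M.eRk_closure_eq, hC.eRk_add_one_eq, hCn]

theorem closure_of_mem {H : Set α} (hH : H ∈ dependentHyperplanes M n) : M.closure H = H := by
  obtain ⟨C, -, -, rfl⟩ := hH
  exact M.closure_closure C

theorem le_encard_of_mem {H : Set α} (hH : H ∈ dependentHyperplanes M n) : n ≤ H.encard := by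
  obtain ⟨C, hC, hCn, rfl⟩ := hH
  rw [← hCn]
  exact Set.encard_le_encard (M.subset_closure C hC.subset_ground)

theorem pos_of_mem {H : Set α} (hH : H ∈ dependentHyperplanes M n) : 0 < n := by
  have h := eRk_add_one_of_mem hH
  rcases Nat.eq_zero_or_pos n with rfl | hn
  · simp at h
  · exact hn

theorem IsPaving.closure_eq_of_subset (hM : IsPaving M n) {H : Set α}
    (hH : H ∈ dependentHyperplanes M n) {X : Set α} (hX : X ⊆ H) (hn : n ≤ X.encard + 1) :
    M.closure X = H := by
  have hpos := pos_of_mem hH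
  have hn1 : ((n - 1 : ℕ) : ℕ∞) + 1 = n := by exact_mod_cast Nat.sub_add_cancel hpos
  obtain ⟨Y, hYX, hY⟩ : ∃ Y ⊆ X, Y.encard = (n - 1 : ℕ) := by
    refine Set.exists_subset_encard_eq ?_
    have : ((n - 1 : ℕ) : ℕ∞) + 1 ≤ X.encard + 1 := by
      rwa [hn1]
    exact (ENat.add_le_add_iff_right (by simp)).1 this
  have hYi : M.Indep Y := hM.indep_of_encard_lt
    ((hYX.trans hX).trans (subset_ground_of_mem hH)) (by rw [hY]; exact_mod_cast by omega)
  have hrk : M.eRk H ≤ M.eRk Y := by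
    rw [hYi.eRk_eq_encard, hY]
    have : M.eRk H + 1 ≤ ((n - 1 : ℕ) : ℕ∞) + 1 := by
      rw [eRk_add_one_of_mem hH, hn1]
    exact (ENat.add_le_add_iff_right (by simp)).1 this
  have hfin : M.IsRkFinite Y := by
    rw [← Matroid.eRk_ne_top_iff, hYi.eRk_eq_encard, hY]
    exact ENat.natCast_ne_top _
  have hYH := hfin.closure_eq_closure_of_subset_of_eRk_ge_eRk (hYX.trans hX) hrk
  rw [closure_of_mem hH] at hYH
  refine subset_antisymm ?_ ?_
  · rw [← closure_of_mem hH]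
    exact M.closure_subset_closure hX
  · rw [← hYH]
    exact M.closure_subset_closure hYX

theorem IsPaving.isCircuit_of_subset (hM : IsPaving M n) {H : Set α}
    (hH : H ∈ dependentHyperplanes M n) {X : Set α} (hX : X ⊆ H) (hn : X.encard = n) :
    M.IsCircuit X := by
  refine hM.isCircuit_of_encard_eq ?_ hn
  rw [← M.not_indep_iff (hX.trans (subset_ground_of_mem hH))]
  intro hi
  have h1 := M.eRk_mono hX
  rw [hi.eRk_eq_encard, hn, ← eRk_add_one_of_mem hH] at h1
  have htop : M.eRk H ≠ ⊤ := fun h => by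
    have h2 := eRk_add_one_of_mem hH
    rw [h, top_add] at h2
    exact ENat.natCast_ne_top n h2.symm
  exact (ENat.lt_add_one_iff htop).2 le_rfl |>.not_ge h1

theorem IsPaving.exists_isCircuit_mem (hM : IsPaving M n) {H : Set α}
    (hH : H ∈ dependentHyperplanes M n) {R : Set α} {p : α} (hp : p ∈ H ∩ R)
    (hR : n ≤ (H ∩ R).encard) :
    ∃ C ⊆ R, M.IsCircuit C ∧ C.encard = n ∧ p ∈ C ∧ M.closure C = H := by
  obtain ⟨C, hpC, hCH, hCn⟩ := Set.exists_superset_subset_encard_eq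
    (Set.singleton_subset_iff.2 hp) (k := n)
    (by rw [Set.encard_singleton]; exact_mod_cast pos_of_mem hH) hR
  have hCH' := hCH.trans Set.inter_subset_left
  exact ⟨C, hCH.trans Set.inter_subset_right, hM.isCircuit_of_subset hH hCH' hCn, hCn,
    hpC rfl, hM.closure_eq_of_subset hH hCH' (by rw [hCn]; exact le_self_add)⟩

/-- A point with degree at most two lies on at most two dependent hyperplanes. -/
theorem IsPaving.eq_of_mem_of_degree_le (hM : IsPaving M n) {p : α} (hp : degree M p ≤ 2)
    {H₁ H₂ H₃ : Set α} (h₁ : H₁ ∈ dependentHyperplanes M n) (h₂ : H₂ ∈ dependentHyperplanes M n)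
    (h₃ : H₃ ∈ dependentHyperplanes M n) (hp₁ : p ∈ H₁) (hp₂ : p ∈ H₂) (hp₃ : p ∈ H₃) :
    H₁ = H₂ ∨ H₁ = H₃ ∨ H₂ = H₃ := by
  have key : ∀ H ∈ dependentHyperplanes M n, p ∈ H → ∃ C : SmallCircuit M,
      p ∈ C.1 ∧ M.closure C.1 = H := fun H hH hpH => by
    have hHE : H ∩ M.E = H := Set.inter_eq_left.2 (subset_ground_of_mem hH)
    obtain ⟨C, -, hC, hCn, hpC, hCH⟩ := hM.exists_isCircuit_mem hH (R := M.E)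
      (by rwa [hHE]) (by rw [hHE]; exact le_encard_of_mem hH)
    refine ⟨⟨C, hC, ?_⟩, hpC, hCH⟩
    rw [hCn, hM.1]
    exact_mod_cast n.lt_succ_self
  obtain ⟨C₁, hpC₁, rfl⟩ := key H₁ h₁ hp₁
  obtain ⟨C₂, hpC₂, rfl⟩ := key H₂ h₂ hp₂
  obtain ⟨C₃, hpC₃, rfl⟩ := key H₃ h₃ hp₃
  by_contra! hne
  let mk : SmallCircuit M → DepSubspace M := Quotient.mk (smallCircuitSetoid M)
  have hmk : ∀ C C' : SmallCircuit M, M.closure C.1 ≠ M.closure C'.1 → mk C ≠ mk C' :=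
    fun C C' h he => h (Quotient.exact he)
  have hsub : ({mk C₁, mk C₂, mk C₃} : Set (DepSubspace M)) ⊆ {l | l.HasPoint p} := by
    rintro l (rfl | rfl | rfl)
    · exact ⟨C₁, rfl, hpC₁⟩
    · exact ⟨C₂, rfl, hpC₂⟩
    · exact ⟨C₃, rfl, hpC₃⟩
  have hcard : ({mk C₁, mk C₂, mk C₃} : Set (DepSubspace M)).encard = 3 :=
    Set.encard_eq_three.2 ⟨_, _, _, hmk _ _ hne.1, hmk _ _ hne.2.1, hmk _ _ hne.2.2, rfl⟩
  have h := (Set.encard_le_encard hsub).trans hp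
  rw [hcard] at h
  exact absurd h (by decide)

/-- A point that lies on two hyperplanes having at least `n` points in `R` has degree greater than
one in the restriction to `R`. Two such hyperplanes force `R` to have full rank `n`, so that the
circuits of size `n` in `R` are again small. -/
theorem IsPaving.mem_multiplePoints (hM : IsPaving M n) {R : Set α} (hR : R ⊆ M.E)
    {H₁ H₂ : Set α} (h₁ : H₁ ∈ dependentHyperplanes M n) (h₂ : H₂ ∈ dependentHyperplanes M n)
    (hne : H₁ ≠ H₂) (hR₁ : n ≤ (H₁ ∩ R).encard) (hR₂ : n ≤ (H₂ ∩ R).encard) {p : α} (hpR : p ∈ R)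
    (hp₁ : p ∈ H₁) (hp₂ : p ∈ H₂) : p ∈ multiplePoints (M ↾ R) := by
  obtain ⟨C₁, hC₁R, hC₁, hC₁n, hpC₁, hC₁H⟩ := hM.exists_isCircuit_mem h₁ ⟨hp₁, hpR⟩ hR₁
  obtain ⟨C₂, hC₂R, hC₂, hC₂n, hpC₂, hC₂H⟩ := hM.exists_isCircuit_mem h₂ ⟨hp₂, hpR⟩ hR₂
  have hrank : (n : ℕ∞) ≤ (M ↾ R).eRank := by
    rw [Matroid.eRank_restrict]
    by_contra! hlt
    have key : ∀ C, C ⊆ R → M.IsCircuit C → C.encard = n → M.closure C = M.closure R := by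
      intro C hCR hC hCn
      have h := hC.eRk_add_one_eq
      rw [hCn] at h
      have htop : M.eRk C ≠ ⊤ := fun h' => by
        rw [h', top_add] at h
        exact ENat.natCast_ne_top n h.symm
      refine Matroid.IsRkFinite.closure_eq_closure_of_subset_of_eRk_ge_eRk
        (Matroid.eRk_ne_top_iff.1 htop) hCR ?_
      rw [← h] at hlt
      exact (ENat.lt_add_one_iff htop).1 hlt
    exact hne (by rw [← hC₁H, ← hC₂H, key C₁ hC₁R hC₁ hC₁n, key C₂ hC₂R hC₂ hC₂n])
  have hsmall : ∀ C : Set α, C.encard = n → C.encard < (M ↾ R).eRank + 1 := fun C hCn => by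
    rw [hCn]
    refine lt_of_lt_of_le ?_ (add_le_add_left hrank 1)
    exact_mod_cast n.lt_succ_self
  let D₁ : SmallCircuit (M ↾ R) :=
    ⟨C₁, (Matroid.restrict_isCircuit_iff hR).2 ⟨hC₁, hC₁R⟩, hsmall C₁ hC₁n⟩
  let D₂ : SmallCircuit (M ↾ R) :=
    ⟨C₂, (Matroid.restrict_isCircuit_iff hR).2 ⟨hC₂, hC₂R⟩, hsmall C₂ hC₂n⟩
  refine ⟨hpR, Set.one_lt_encard_iff.2 ⟨Quotient.mk _ D₁, Quotient.mk _ D₂, ⟨D₁, rfl, hpC₁⟩,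
    ⟨D₂, rfl, hpC₂⟩, fun he => hne ?_⟩⟩
  have hcl : (M ↾ R).closure C₁ = (M ↾ R).closure C₂ := Quotient.exact he
  rw [M.restrict_closure_eq hC₁R hR, M.restrict_closure_eq hC₂R hR, hC₁H, hC₂H] at hcl
  have hsub : C₂ ⊆ H₁ := fun q hq => by
    have : q ∈ H₂ ∩ R := ⟨hC₂H ▸ M.subset_closure C₂ hC₂.subset_ground hq, hC₂R hq⟩
    rw [← hcl] at this
    exact this.1
  rw [← hC₂H, hM.closure_eq_of_subset h₁ hsub (by rw [hC₂n]; exact le_self_add)]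

theorem exists_nilpotentChain_eq_restrict (M : Matroid α) (j : ℕ) :
    ∃ R ⊆ M.E, nilpotentChain M j = M ↾ R := by
  induction j with
  | zero => exact ⟨M.E, subset_rfl, M.restrict_ground_eq_self.symm⟩
  | succ j ih =>
    obtain ⟨R, hR, h⟩ := ih
    have hsub : multiplePoints (M ↾ R) ⊆ R := fun p hp => hp.1
    refine ⟨multiplePoints (M ↾ R), hsub.trans hR, ?_⟩
    rw [nilpotentChain, h]
    exact M.restrict_restrict_eq hsub

/-- If every hyperplane in `T` contained at least `n` of the points common to two members of `T`,
then these common points would survive in every step of the nilpotent chain. -/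
theorem IsPaving.isSparseIncidence (hM : IsPaving M n) (hnilp : IsNilpotent M)
    (hdeg : ∀ p ∈ M.E, degree M p ≤ 2) : IsSparseIncidence (hyperplaneInc M n) n where
  eq_of_inc p u v w hu hv hw := by
    simpa only [Subtype.ext_iff] using
      hM.eq_of_mem_of_degree_le (hdeg p p.2) u.2 v.2 w.2 hu hv hw
  card_inter v w hvw s hs := by
    by_contra! hlt
    let X : Set α := Subtype.val '' (s : Set M.E)
    have hX : X.encard = s.card := by
      rw [Subtype.val_injective.encard_image, Set.encard_coe_eq_coe_finsetCard]
    have hn : (n : ℕ∞) ≤ X.encard + 1 := by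
      rw [hX]
      exact_mod_cast by omega
    refine hvw (Subtype.ext ?_)
    rw [← hM.closure_eq_of_subset v.2 (X := X) (by rintro _ ⟨p, hp, rfl⟩; exact (hs p hp).1) hn,
      ← hM.closure_eq_of_subset w.2 (X := X) (by rintro _ ⟨p, hp, rfl⟩; exact (hs p hp).2) hn]
  degenerate T hT := by
    by_contra! hcon
    let S : Set α := {p | ∃ v ∈ T, ∃ w ∈ T, v ≠ w ∧ p ∈ v.1 ∧ p ∈ w.1}
    have hle : ∀ v ∈ T, ∀ R : Set α, S ⊆ R → n ≤ (v.1 ∩ R).encard := fun v hv R hSR => by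
      obtain ⟨s, hs, hsn⟩ := hcon v hv
      have h1 : (n : ℕ∞) ≤ (Subtype.val '' (s : Set M.E)).encard := by
        rw [Subtype.val_injective.encard_image, Set.encard_coe_eq_coe_finsetCard]
        exact_mod_cast by omega
      refine h1.trans (Set.encard_le_encard ?_)
      rintro _ ⟨p, hp, rfl⟩
      obtain ⟨hvp, w, hw, hwv, hwp⟩ := hs p hp
      exact ⟨hvp, hSR ⟨v, hv, w, hw, hwv.symm, hvp, hwp⟩⟩
    have hchain : ∀ j, S ⊆ (nilpotentChain M j).E := fun j => by
      induction j with
      | zero =>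
        rintro p ⟨v, -, -, -, -, hp, -⟩
        exact subset_ground_of_mem v.2 hp
      | succ j ih =>
        obtain ⟨R, hR, h⟩ := exists_nilpotentChain_eq_restrict M j
        rw [nilpotentChain]
        rw [h] at ih ⊢
        rintro p hpS
        obtain ⟨v, hv, w, hw, hvw, hpv, hpw⟩ := id hpS
        exact hM.mem_multiplePoints hR v.2 w.2 (fun he => hvw (Subtype.ext he)) (hle v hv R ih)
          (hle w hw R ih) (ih hpS) hpv hpw
    obtain ⟨j, hj⟩ := hnilp
    obtain ⟨v, hv⟩ := hT
    have h := hle v hv ∅ (by rw [← hj]; exact hchain j)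
    have hpos := pos_of_mem v.2
    simp at h
    omega

end paving

/-! ### The two varieties -/

theorem encard_le_finrank_of_linearIndepOn {E : Type*} [Finite E] {n : ℕ} {γ : E → Fin n → ℂ}
    {D : Set E} (hD : LinearIndepOn ℂ γ D) {W : Submodule ℂ (Fin n → ℂ)} (hW : ∀ p ∈ D, γ p ∈ W) :
    D.encard ≤ Module.finrank ℂ W := by
  classical
  cases nonempty_fintype E
  have h : LinearIndependent ℂ fun p : D => (⟨γ p, hW p p.2⟩ : W) :=
    LinearIndependent.of_comp W.subtype hD
  have := h.fintype_card_le_finrank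
  rw [← Set.toFinset_card] at this
  rw [Set.encard_eq_coe_toFinset_card]
  exact_mod_cast this

section varieties

variable {α : Type*} {M : Matroid α} {n : ℕ}

theorem closure_subset_matroidVariety : closure (realizationSpace M n) ⊆ matroidVariety M n := by
  intro x hx f hf
  have hcl : IsClosed {y : Fin n × M.E → ℂ | MvPolynomial.eval y f = 0} :=
    isClosed_eq (MvPolynomial.continuous_eval f) continuous_const
  have := closure_minimal (s := realizationSpace M n)
    (fun y hy => by simpa [MvPolynomial.coe_aeval_eq_eval] using hf y hy) hcl hx
  simpa [MvPolynomial.coe_aeval_eq_eval] using this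

theorem aeval_minor (x : Fin n × M.E → ℂ) (A : Finset (Fin n)) (g : A → M.E) :
    MvPolynomial.aeval x
      ((mvPolynomialX (Fin n) M.E ℂ).submatrix (fun i : A => (i : Fin n)) g).det =
      (Matrix.of fun i j : A => columns x (g j) i).det := by
  rw [AlgHom.map_det]
  congr 1
  ext i j
  simp [columns]

theorem matroidVariety_subset_circuitVariety : matroidVariety M n ⊆ circuitVariety M n := by
  refine MvPolynomial.zeroLocus_anti_mono ?_
  refine Ideal.span_le.2 ?_
  rintro _ ⟨A, g, hg, hC, rfl⟩ x hx
  rw [aeval_minor]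
  by_contra hdet
  have hind : LinearIndependent ℂ (Matrix.of fun i j : A => columns x (g j) i)ᵀ.row :=
    Matrix.linearIndependent_rows_iff_isUnit.2
      ((Matrix.isUnit_iff_isUnit_det _).2 (by rw [det_transpose]; exact Ne.isUnit hdet))
  have hind' : LinearIndependent ℂ fun j : A => columns x (g j) :=
    LinearIndependent.of_comp (LinearMap.funLeft ℂ ℂ fun i : A => (i : Fin n)) hind
  have hOn : LinearIndepOn ℂ (columns x) (Set.range g) :=
    (linearIndepOn_range_iff hg _).2 hind'
  have := (hx _).1 hOn
  rw [← Set.range_comp] at this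
  exact hC.dep.not_indep this

/-- On the circuit variety, the vectors of each dependent hyperplane lie on a linear hyperplane,
since any `n` of its points form a circuit. -/
theorem exists_normal_of_mem_circuitVariety (hM : IsPaving M n) {x : Fin n × M.E → ℂ}
    (hx : x ∈ circuitVariety M n) (H : dependentHyperplanes M n) :
    ∃ φ : Fin n → ℂ, φ ≠ 0 ∧ ∀ p, hyperplaneInc M n H p → φ ⬝ᵥ columns x p = 0 := by
  let v : {p // hyperplaneInc M n H p} → Fin n → ℂ := fun p => columns x p
  by_cases htop : Submodule.span ℂ (Set.range v) = ⊤
  · exfalso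
    obtain ⟨κ, a, ha, hspan, hind⟩ := exists_linearIndependent' ℂ v
    let b := Module.Basis.mk hind (by rw [hspan, htop])
    let e : (Finset.univ : Finset (Fin n)) ≃ κ :=
      (Equiv.subtypeUnivEquiv fun i => Finset.mem_univ i).trans
        ((Pi.basisFun ℂ (Fin n)).indexEquiv b)
    let g : ↥(Finset.univ : Finset (Fin n)) → M.E := fun i => (a (e i)).1
    have hg : Function.Injective g := Subtype.val_injective.comp (ha.comp e.injective)
    have hC : M.IsCircuit (Set.range fun i => (g i : α)) := by
      refine hM.isCircuit_of_subset H.2 ?_ ?_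
      · rintro _ ⟨i, rfl⟩
        exact (a (e i)).2
      · have hinj : Function.Injective fun i => (g i : α) := Subtype.val_injective.comp hg
        rw [← Set.image_univ, hinj.encard_image, Set.encard_univ]
        simp
    have hmem := hx _ (Ideal.subset_span ⟨Finset.univ, g, hg, hC, rfl⟩)
    rw [aeval_minor] at hmem
    have hli : LinearIndependent ℂ
        (Matrix.of fun (i j : (Finset.univ : Finset (Fin n))) => columns x (g j) i)ᵀ.row := by
      have h1 : LinearIndependent ℂ fun j => columns x (g j) := hind.comp e e.injective
      exact h1.map' (LinearMap.funLeft ℂ ℂ fun i : (Finset.univ : Finset (Fin n)) => (i : Fin n))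
        (LinearMap.ker_eq_bot.2 (LinearMap.funLeft_injective_of_surjective _ _ _
          fun i => ⟨⟨i, Finset.mem_univ i⟩, rfl⟩))
    have := (Matrix.isUnit_iff_isUnit_det _).1 (Matrix.linearIndependent_rows_iff_isUnit.1 hli)
    rw [det_transpose, hmem] at this
    exact not_isUnit_zero this
  · obtain ⟨f, hf, hle⟩ := Submodule.exists_le_ker_of_lt_top _ (lt_top_iff_ne_top.2 htop)
    refine ⟨(dotProductEquiv ℂ (Fin n)).symm f, by simpa using hf, fun p hp => ?_⟩
    have h0 : f (columns x p) = 0 := hle (Submodule.subset_span ⟨⟨p, hp⟩, rfl⟩)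
    rw [← h0]
    exact congrArg (fun h => h (columns x p)) ((dotProductEquiv ℂ (Fin n)).apply_symm_apply f)

/-- A generic configuration on the dependent hyperplanes realizes `M`. -/
theorem mem_realizationSpace_of_mem_genericLocus [M.Finite] (hM : IsPaving M n)
    {γ : M.E → Fin n → ℂ} (hγ : γ ∈ genericLocus (hyperplaneInc M n) n) :
    (fun ip : Fin n × M.E => γ ip.2 ip.1) ∈ realizationSpace M n := by
  have : Finite M.E := M.ground_finite
  intro I
  change LinearIndepOn ℂ γ I ↔ _
  constructor
  · intro hI
    by_contra hdep
    have hIE : Subtype.val '' I ⊆ M.E := by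
      rintro _ ⟨p, -, rfl⟩
      exact p.2
    obtain ⟨C, hCI, hC⟩ := ((M.not_indep_iff hIE).1 hdep).exists_isCircuit_subset
    have hCD : Subtype.val '' (Subtype.val ⁻¹' C : Set M.E) = C :=
      Subtype.image_preimage_coe _ _ |>.trans (Set.inter_eq_right.2 hC.subset_ground)
    have hD : (Subtype.val ⁻¹' C : Set M.E).encard = C.encard := by
      rw [← Subtype.val_injective.encard_image, hCD]
    have hDI : (Subtype.val ⁻¹' C : Set M.E) ⊆ I := by
      rw [← Set.image_subset_image_iff Subtype.val_injective, hCD]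
      exact hCI
    have hDi := hI.mono hDI
    rcases hM.2 C hC with hn | hn
    · let H : dependentHyperplanes M n := ⟨M.closure C, C, hC, hn, rfl⟩
      obtain ⟨φ, hφ, h⟩ := hγ.1 H
      have hle := encard_le_finrank_of_linearIndepOn hDi (W := orthogonal φ)
        fun p hp => mem_orthogonal.2 (h p (M.subset_closure C hC.subset_ground hp))
      have hfin := finrank_orthogonal hφ
      rw [hD, hn] at hle
      have : n ≤ Module.finrank ℂ (orthogonal φ) := by exact_mod_cast hle
      omega
    · have hle := encard_le_finrank_of_linearIndepOn hDi (W := ⊤) fun p _ => trivial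
      rw [hD, hn, finrank_top, Module.finrank_fin_fun] at hle
      have : n + 1 ≤ n := by exact_mod_cast hle
      omega
  · intro hI
    obtain ⟨B, hB, hIB⟩ := hI.exists_isBase_superset
    have hBn : B.encard = n := by rw [hB.encard_eq_eRank, hM.1]
    have hBfin : B.Finite := Set.finite_of_encard_eq_coe hBn
    have := hBfin.fintype
    have hcard : Fintype.card B = n := by
      rw [← Set.toFinset_card]
      rw [Set.encard_eq_coe_toFinset_card] at hBn
      exact_mod_cast hBn
    let e : Fin n ≃ B := (Fintype.equivFinOfCardEq hcard).symm
    let b : Fin n ↪ M.E :=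
      ⟨fun i => ⟨e i, hB.subset_ground (e i).2⟩, fun i j h =>
        e.injective (Subtype.val_injective (congrArg (Subtype.val : M.E → α) h))⟩
    have hli := hγ.2 b (by
      intro H
      by_contra! hall
      have hBH : B ⊆ H.1 := fun p hp => by
        have h : (e (e.symm ⟨p, hp⟩) : α) ∈ H.1 := hall (e.symm ⟨p, hp⟩)
        rwa [e.apply_symm_apply] at h
      exact (hM.isCircuit_of_subset H.2 hBH hBn).dep.not_indep hB.indep)
    refine ((linearIndepOn_range_iff b.injective _).2 hli).mono fun p hp => ?_
    refine ⟨e.symm ⟨p, hIB ⟨p, hp, rfl⟩⟩, Subtype.ext ?_⟩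
    change (e (e.symm _) : α) = p
    rw [e.apply_symm_apply]

end varieties

end MatVar

theorem mainTheorem2 {α : Type*} (M : Matroid α) [M.Finite] (n : ℕ)
    (hpaving : MatVar.IsPaving M n) (hnilp : MatVar.IsNilpotent M)
    (hdeg : ∀ p ∈ M.E, MatVar.degree M p ≤ 2) :
    MatVar.matroidVariety M n = MatVar.circuitVariety M n := by
  refine subset_antisymm MatVar.matroidVariety_subset_circuitVariety fun x hx => ?_
  have : Finite M.E := M.ground_finite
  have : Finite (MatVar.dependentHyperplanes M n) :=
    (M.ground_finite.finite_subsets.subset fun H hH => MatVar.subset_ground_of_mem hH)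
  have hinc := hpaving.isSparseIncidence hnilp hdeg
  have h₁ := MatVar.mem_closure_distinctLocus hinc
    (MatVar.exists_normal_of_mem_circuitVariety hpaving hx)
  have h₂ := closure_minimal (MatVar.distinctLocus_subset_closure hinc) isClosed_closure h₁
  have hcont : Continuous fun (γ : M.E → Fin n → ℂ) (ip : Fin n × M.E) => γ ip.2 ip.1 := by
    fun_prop
  exact MatVar.closure_subset_matroidVariety (map_mem_closure hcont h₂
    fun γ hγ => MatVar.mem_realizationSpace_of_mem_genericLocus hpaving hγ)
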